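/- Let $k$ be a field and let $\mathcal C$ be a skeletally small, Hom-finite, Krull–Schmidt, $k$-linear triangulated category with suspension functor $\Sigma$ and with Serre duality, i.e. an autoequivalence $\nu$ of $\mathcal C$ with $k$-linear isomorphisms $\operatorname{Hom}_{\mathcal C}(X,Y)\cong \operatorname{Hom}_k(\operatorname{Hom}_{\mathcal C}(Y,\nu X),k)$ natural in $X$ and $Y$. Let $T$ be a rigid object of $\mathcal C$, i.e. $\operatorname{Ext}^1(T,T)=\operatorname{Hom}_{\mathcal C}(T,\Sigma T)=0$. Let $\mathcal X_T=(\Sigma T)^\perp$ be the full subcategory of those objects $C$ with $\operatorname{Ext}^1(X,C)=\operatorname{Hom}_{\mathcal C}(X,\Sigma C)=0$ for every $X$ in the additive closure $\operatorname{add}\Sigma T$; equivalently, $\operatorname{Hom}_{\mathcal C}(T,C)=0$. Let $\mathcal C/\mathcal X_T$ be the factor category, which has the same objects as $\mathcal C$ and whose morphisms are the morphisms of $\mathcal C$ modulo those factoring through an object of $\mathcal X_T$. Write $\underline f$ for the image in $\mathcal C/\mathcal X_T$ of a morphism $f$ of $\mathcal C$; thus $\underline f=0$ if and only if $f$ factors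 through an object of $\mathcal X_T$. A morphism is called regular if it is both a monomorphism and an epimorphism. Let $\Sigma^{-1}Z\xrightarrow{h}X\xrightarrow{f}Y\xrightarrow{g}Z$ be a distinguished triangle in $\mathcal C$. Then: (a) $\underline f$ is a monomorphism in $\mathcal C/\mathcal X_T$ if and only if $\underline h=0$; (b) $\underline f$ is an epimorphism in $\mathcal C/\mathcal X_T$ if and only if $\underline g=0$; (c) $\underline f$ is regular if and only if $\underline g=0=\underline h$. -/

import Mathlib

open CategoryTheory CategoryTheory.Limits CategoryTheory.Pretriangulated

universe w v u

namespace RigidQuotient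

/-- A category is Krull-Schmidt if every object is a finite direct sum of objects with local
endomorphism rings (the empty direct sum being the zero object). -/
def IsKrullSchmidt (C : Type u) [Category.{v} C] [Preadditive C] [HasFiniteBiproducts C] : Prop :=
  ∀ X : C, ∃ (n : ℕ) (F : Fin n → C), (∀ i, IsLocalRing (End (F i))) ∧ Nonempty (X ≅ ⨁ F)

/-- A `k`-linear category is Hom-finite if all its Hom-spaces are finite dimensional. -/
def IsHomFinite (k : Type w) [Field k] (C : Type u) [Category.{v} C] [Preadditive C]
    [Linear k C] : Prop :=
  ∀ X Y : C, Module.Finite k (X ⟶ Y)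

/-- A Serre duality: an autoequivalence `ν` with isomorphisms `Hom(X, Y) ≃ D Hom(Y, ν X)`,
natural in `X` and `Y`, where `D = Hom_k(-, k)`. -/
structure SerreDuality (k : Type w) [Field k] (C : Type u) [Category.{v} C] [Preadditive C]
    [Linear k C] where
  /-- the Serre functor -/
  ν : C ≌ C
  /-- the duality isomorphisms -/
  dual : ∀ X Y : C, (X ⟶ Y) ≃ₗ[k] Module.Dual k (Y ⟶ ν.functor.obj X)
  /-- naturality of the duality isomorphisms in both variables -/
  dual_natural : ∀ {X X' Y Y' : C} (a : X' ⟶ X) (b : Y ⟶ Y') (f : X ⟶ Y)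
    (φ : Y' ⟶ ν.functor.obj X'),
    dual X' Y' (a ≫ f ≫ b) φ = dual X Y f (b ≫ φ ≫ ν.functor.map a)

/-- `f` factors through an object of the full subcategory `P`. -/
def FactorsThrough {C : Type u} [Category.{v} C] (P : ObjectProperty C) {X Y : C}
    (f : X ⟶ Y) : Prop :=
  ∃ (U : C) (a : X ⟶ U) (b : U ⟶ Y), P U ∧ a ≫ b = f

/-- A morphism is regular if it is both a monomorphism and an epimorphism. -/
def IsRegularMorphism {C : Type u} [Category.{v} C] {X Y : C} (f : X ⟶ Y) : Prop :=
  Mono f ∧ Epi f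

section Triangulated

variable {C : Type u} [Category.{v} C] [Preadditive C] [HasZeroObject C] [HasShift C ℤ]
  [∀ n : ℤ, (shiftFunctor C n).Additive] [Pretriangulated C]

/-- `Ext¹(X, Y) = Hom(X, ΣY)`, where `Σ` is the suspension. -/
abbrev Ext1 (X Y : C) : Type v := X ⟶ Y⟦(1 : ℤ)⟧

/-- `T` is rigid if `Ext¹(T, T) = 0`. -/
def IsRigid (T : C) : Prop := ∀ e : Ext1 T T, e = 0

/-- The additive closure of `X`: the direct summands of finite direct sums of copies of `X`. -/
def addClosure (X : C) : ObjectProperty C :=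
  fun Y => ∃ n : ℕ, Nonempty (Retract Y (⨁ fun _ : Fin n => X))

/-- The right perpendicular subcategory, consisting of those `Y` with `Ext¹(X, Y) = 0` for all
`X` in `P`. -/
def rightPerp (P : ObjectProperty C) : ObjectProperty C :=
  fun Y => ∀ X, P X → ∀ e : Ext1 X Y, e = 0

/-- The subcategory `X_T = (ΣT)^⊥ = (add ΣT)^⊥`. -/
def XT (T : C) : ObjectProperty C := rightPerp (addClosure (T⟦(1 : ℤ)⟧))

/-- An object is in `X_T` if and only if `Hom(T, Y) = 0`. -/
theorem XT_iff (T Y : C) : XT T Y ↔ ∀ g : T ⟶ Y, g = 0 := by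
  constructor
  · intro h g
    have hT : addClosure (T⟦(1 : ℤ)⟧) (T⟦(1 : ℤ)⟧) :=
      ⟨1, ⟨{ i := biproduct.ι (fun _ : Fin 1 => T⟦(1 : ℤ)⟧) 0
             r := biproduct.π (fun _ : Fin 1 => T⟦(1 : ℤ)⟧) 0
             retract := biproduct.ι_π_self _ _ }⟩⟩
    apply (shiftFunctor C (1 : ℤ)).map_injective
    rw [Functor.map_zero]
    exact h _ hT _
  · rintro h X ⟨n, ⟨r⟩⟩ e
    have h' : r.r ≫ e = 0 := by
      refine biproduct.hom_ext' _ _ fun j => ?_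
      obtain ⟨g, hg⟩ := (shiftFunctor C (1 : ℤ)).map_surjective
        (biproduct.ι (fun _ : Fin n => T⟦(1 : ℤ)⟧) j ≫ r.r ≫ e)
      rw [← hg, h g, Functor.map_zero, comp_zero]
    calc e = r.i ≫ r.r ≫ e := by rw [r.retract_assoc]
      _ = 0 := by rw [h', comp_zero]

/-- Morphisms `f, g` are identified in `C/X_T` when `f - g` factors through `X_T`. -/
def factorRel (T : C) : HomRel C := fun _ _ f g => FactorsThrough (XT T) (f - g)

open scoped ZeroObject in
theorem factorsThrough_zero (T : C) (X Y : C) : FactorsThrough (XT T) (0 : X ⟶ Y) :=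
  ⟨(0 : C), 0, 0, (XT_iff T (0 : C)).2 fun _ => (isZero_zero C).eq_of_tgt _ _, by simp⟩

theorem factorsThrough_add (T : C) {X Y : C} {f g : X ⟶ Y} (hf : FactorsThrough (XT T) f)
    (hg : FactorsThrough (XT T) g) : FactorsThrough (XT T) (f + g) := by
  obtain ⟨U, a, b, hU, rfl⟩ := hf
  obtain ⟨V, c, d, hV, rfl⟩ := hg
  refine ⟨U ⊞ V, biprod.lift a c, biprod.desc b d, ?_, by simp⟩
  rw [XT_iff] at hU hV ⊢
  intro t
  apply biprod.hom_ext
  · rw [hU (t ≫ biprod.fst), zero_comp]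
  · rw [hV (t ≫ biprod.snd), zero_comp]

theorem factorsThrough_neg (T : C) {X Y : C} {f : X ⟶ Y} (hf : FactorsThrough (XT T) f) :
    FactorsThrough (XT T) (-f) := by
  obtain ⟨U, a, b, hU, rfl⟩ := hf
  exact ⟨U, -a, b, hU, by simp⟩

instance factorRel_congruence (T : C) : Congruence (factorRel T) where
  equivalence :=
    { refl := fun f => by
        simpa [factorRel] using factorsThrough_zero T _ _
      symm := fun {f g} h => by
        simpa [factorRel] using factorsThrough_neg T h
      trans := fun {f g h} h₁ h₂ => by
        simpa [factorRel] using factorsThrough_add T h₁ h₂ }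
  comp_left := by
    rintro X Y Z f g g' ⟨U, a, b, hU, h⟩
    exact ⟨U, f ≫ a, b, hU, by simp [h]⟩
  comp_right := by
    rintro X Y Z f f' g ⟨U, a, b, hU, h⟩
    exact ⟨U, a, b ≫ g, hU, by rw [← Category.assoc, h, Preadditive.sub_comp]⟩

/-- The factor category `C/X_T`: its objects are those of `C`, and its morphisms are the morphisms
of `C` modulo those factoring through `X_T`. -/
abbrev FactorCategory (T : C) : Type u := Quotient (factorRel T)

theorem factorRel_add (T : C) ⦃X Y : C⦄ (f₁ f₂ g₁ g₂ : X ⟶ Y) (hf : factorRel T f₁ f₂)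
    (hg : factorRel T g₁ g₂) : factorRel T (f₁ + g₁) (f₂ + g₂) := by
  have h := factorsThrough_add T hf hg
  rwa [← add_sub_add_comm] at h

instance factorCategoryPreadditive (T : C) : Preadditive (FactorCategory T) :=
  Quotient.preadditive (factorRel T) (factorRel_add T)

/-- The canonical functor from `C` to `C/X_T`. -/
abbrev toFactor (T : C) : C ⥤ FactorCategory T := Quotient.functor (factorRel T)

instance toFactor_additive (T : C) : (toFactor T).Additive :=
  Quotient.functor_additive (factorRel T) (factorRel_add T)

theorem toFactor_map_eq_zero_iff (T : C) {X Y : C} (f : X ⟶ Y) :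
    (toFactor T).map f = 0 ↔ FactorsThrough (XT T) f := by
  rw [← (toFactor T).map_zero X Y, Quotient.functor_map_eq_iff, factorRel, sub_zero]

end Triangulated

end RigidQuotient

open RigidQuotient

/-! The functor to `C/X_T` is full, and when `T` is rigid it kills exactly the morphisms killed by
`Hom(T, -)`: if `t ≫ a = 0` for all `t : T ⟶ X`, then `a` factors through the cone of a right
`add T`-approximation of `X`, and rigidity of `T` puts this cone in `X_T`. So `f` becomes a
monomorphism (an epimorphism) in `C/X_T` as soon as `Hom(T, f)` is injective (surjective), which the
long exact sequence of `Hom(T, -)` reads off from the neighbouring map of the triangle. -/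

namespace RigidQuotient

section Approximation

variable {C : Type u} [Category.{v} C]

/-- A right `P`-approximation (or `P`-precover) of `X`: a morphism from an object of `P` to `X`
through which every morphism from an object of `P` to `X` factors, not necessarily uniquely. -/
structure IsRightApproximation (P : ObjectProperty C) {A X : C} (p : A ⟶ X) : Prop where
  prop_source : P A
  exists_lift : ∀ {B : C}, P B → ∀ b : B ⟶ X, ∃ s : B ⟶ A, s ≫ p = b

/-- A full subcategory is contravariantly finite if every object has a right approximation by it.
Approximations by `add T` serve to factor a morphism killed by `Hom(T, -)` through `X_T`. -/
def IsContravariantlyFinite (P : ObjectProperty C) : Prop :=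
  ∀ X : C, ∃ (A : C) (p : A ⟶ X), IsRightApproximation P p

end Approximation

section Triangulated

variable {C : Type u} [Category.{v} C] [Preadditive C] [HasZeroObject C] [HasShift C ℤ]
  [∀ n : ℤ, (shiftFunctor C n).Additive] [Pretriangulated C] {T : C}

theorem addClosure_biproduct (T : C) (n : ℕ) : addClosure T (⨁ fun _ : Fin n => T) :=
  ⟨n, ⟨Retract.refl _⟩⟩

theorem addClosure_self (T : C) : addClosure T T :=
  ⟨1, ⟨{ i := biproduct.ι (fun _ : Fin 1 => T) 0
         r := biproduct.π (fun _ : Fin 1 => T) 0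
         retract := biproduct.ι_π_self _ _ }⟩⟩

theorem addClosure.eq_zero_of_forall_comp {A Y : C} (hA : addClosure T A) {a : A ⟶ Y}
    (ha : ∀ t : T ⟶ A, t ≫ a = 0) : a = 0 := by
  obtain ⟨n, ⟨ρ⟩⟩ := hA
  have hr : ρ.r ≫ a = 0 := biproduct.hom_ext' _ _ fun i => by
    rw [comp_zero, ← Category.assoc, ha]
  rw [← ρ.retract_assoc a, hr, comp_zero]

theorem addClosure.exists_lift {A B X : C} (hB : addClosure T B) {p : A ⟶ X}
    (hp : ∀ t : T ⟶ X, ∃ s, s ≫ p = t) (b : B ⟶ X) : ∃ s, s ≫ p = b := by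
  obtain ⟨n, ⟨ρ⟩⟩ := hB
  choose s hs using fun i => hp (biproduct.ι (fun _ : Fin n => T) i ≫ ρ.r ≫ b)
  have hdesc : biproduct.desc s ≫ p = ρ.r ≫ b := biproduct.hom_ext' _ _ fun i => by
    rw [biproduct.ι_desc_assoc, hs]
  exact ⟨ρ.i ≫ biproduct.desc s, by rw [Category.assoc, hdesc, ρ.retract_assoc]⟩

theorem IsRigid.ext1_addClosure_eq_zero (hT : IsRigid T) {A : C} (hA : addClosure T A)
    (e : Ext1 T A) : e = 0 := by
  obtain ⟨n, ⟨ρ⟩⟩ := hA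
  let F := shiftFunctor C (1 : ℤ)
  have hi : e ≫ F.map ρ.i = 0 := by
    rw [← cancel_mono (F.mapBiproduct fun _ : Fin n => T).hom, zero_comp]
    exact biproduct.hom_ext _ _ fun i => (hT _).trans zero_comp.symm
  rw [← Category.comp_id e, ← (ρ.map F).retract, Retract.map_i, reassoc_of% hi, zero_comp]

theorem isContravariantlyFinite_addClosure {R : Type w} [Semiring R] [Linear R C]
    (hfin : ∀ X : C, Module.Finite R (T ⟶ X)) : IsContravariantlyFinite (addClosure T) := by
  intro X
  have := hfin X
  obtain ⟨n, e, he⟩ := Module.Finite.exists_fin (R := R) (M := T ⟶ X)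
  refine ⟨_, biproduct.desc e, addClosure_biproduct T n, fun hB => hB.exists_lift fun t => ?_⟩
  obtain ⟨c, rfl⟩ := (Submodule.mem_span_range_iff_exists_fun R).1 (he ▸ Submodule.mem_top (x := t))
  exact ⟨biproduct.lift fun i => c i • 𝟙 T, by simp [biproduct.lift_desc]⟩

theorem IsRigid.XT_obj₃_of_isRightApproximation (hT : IsRigid T) {Δ : Triangle C}
    (hΔ : Δ ∈ distTriang C) (happrox : IsRightApproximation (addClosure T) Δ.mor₁) :
    XT T Δ.obj₃ := by
  refine (XT_iff T Δ.obj₃).2 fun t => ?_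
  obtain ⟨x, rfl⟩ := Triangle.coyoneda_exact₃ _ hΔ t
    (hT.ext1_addClosure_eq_zero happrox.prop_source _)
  obtain ⟨s, rfl⟩ := happrox.exists_lift (addClosure_self T) x
  rw [Category.assoc, comp_distTriang_mor_zero₁₂ _ hΔ, comp_zero]

theorem IsRigid.toFactor_map_eq_zero_iff_forall_comp (hT : IsRigid T)
    (hfin : IsContravariantlyFinite (addClosure T)) {X Y : C} (a : X ⟶ Y) :
    (toFactor T).map a = 0 ↔ ∀ t : T ⟶ X, t ≫ a = 0 := by
  rw [toFactor_map_eq_zero_iff]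
  constructor
  · rintro ⟨U, b, c, hU, rfl⟩ t
    rw [← Category.assoc, (XT_iff T U).1 hU (t ≫ b), zero_comp]
  · intro ha
    obtain ⟨A, p, hp⟩ := hfin X
    obtain ⟨V, q, r, hΔ⟩ := distinguished_cocone_triangle p
    have hpa : p ≫ a = 0 := hp.prop_source.eq_zero_of_forall_comp fun t => by
      rw [← Category.assoc, ha]
    obtain ⟨b, hb⟩ := Triangle.yoneda_exact₂ _ hΔ a hpa
    exact ⟨V, q, b, hT.XT_obj₃_of_isRightApproximation hΔ hp, hb.symm⟩

theorem IsRigid.mono_toFactor_map (hT : IsRigid T)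
    (hfin : IsContravariantlyFinite (addClosure T)) {X Y : C} {f : X ⟶ Y}
    (hf : ∀ t : T ⟶ X, t ≫ f = 0 → t = 0) : Mono ((toFactor T).map f) := by
  refine Preadditive.mono_of_cancel_zero _ fun {W} a ha => ?_
  obtain ⟨W⟩ := W
  obtain ⟨a, rfl⟩ := (toFactor T).map_surjective (X := W) a
  rw [← Functor.map_comp, hT.toFactor_map_eq_zero_iff_forall_comp hfin] at ha
  exact (hT.toFactor_map_eq_zero_iff_forall_comp hfin a).2 fun t =>
    hf _ (by rw [Category.assoc, ha])

theorem IsRigid.epi_toFactor_map (hT : IsRigid T)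
    (hfin : IsContravariantlyFinite (addClosure T)) {X Y : C} {f : X ⟶ Y}
    (hf : ∀ t : T ⟶ Y, ∃ s, t = s ≫ f) : Epi ((toFactor T).map f) := by
  refine Preadditive.epi_of_cancel_zero _ fun {W} a ha => ?_
  obtain ⟨W⟩ := W
  obtain ⟨a, rfl⟩ := (toFactor T).map_surjective (Y := W) a
  rw [← Functor.map_comp, hT.toFactor_map_eq_zero_iff_forall_comp hfin] at ha
  refine (hT.toFactor_map_eq_zero_iff_forall_comp hfin a).2 fun t => ?_
  obtain ⟨s, rfl⟩ := hf t
  rw [Category.assoc, ha]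

theorem IsRigid.mono_toFactor_map_iff (hT : IsRigid T)
    (hfin : IsContravariantlyFinite (addClosure T)) {A X Y : C} {h : A ⟶ X} {f : X ⟶ Y}
    {δ : Y ⟶ A⟦(1 : ℤ)⟧} (hΔ : Triangle.mk h f δ ∈ distTriang C) :
    Mono ((toFactor T).map f) ↔ (toFactor T).map h = 0 := by
  have hhf : h ≫ f = 0 := comp_distTriang_mor_zero₁₂ _ hΔ
  constructor
  · intro _
    apply zero_of_comp_mono ((toFactor T).map f)
    rw [← Functor.map_comp, hhf, Functor.map_zero]
  · refine fun hh => hT.mono_toFactor_map hfin fun t ht => ?_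
    obtain ⟨s, rfl⟩ := Triangle.coyoneda_exact₂ _ hΔ t ht
    exact (hT.toFactor_map_eq_zero_iff_forall_comp hfin h).1 hh s

theorem IsRigid.epi_toFactor_map_iff (hT : IsRigid T)
    (hfin : IsContravariantlyFinite (addClosure T)) {A X Y : C} {h : A ⟶ X} {f : X ⟶ Y}
    {δ : Y ⟶ A⟦(1 : ℤ)⟧} (hΔ : Triangle.mk h f δ ∈ distTriang C) :
    Epi ((toFactor T).map f) ↔ (toFactor T).map δ = 0 := by
  have hfδ : f ≫ δ = 0 := comp_distTriang_mor_zero₂₃ _ hΔ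
  constructor
  · intro _
    apply zero_of_epi_comp ((toFactor T).map f)
    rw [← Functor.map_comp, hfδ, Functor.map_zero]
  · exact fun hδ => hT.epi_toFactor_map hfin fun t =>
      Triangle.coyoneda_exact₃ _ hΔ t ((hT.toFactor_map_eq_zero_iff_forall_comp hfin δ).1 hδ t)

end Triangulated

end RigidQuotient

theorem lemma3p3_general {C : Type u} [Category.{v} C] [Preadditive C] [HasZeroObject C]
    [HasShift C ℤ] [∀ n : ℤ, (shiftFunctor C n).Additive] [Pretriangulated C]
    {T : C} (hT : IsRigid T) (hfin : IsContravariantlyFinite (addClosure T))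
    {X Y Z : C} (h : Z⟦(-1 : ℤ)⟧ ⟶ X) (f : X ⟶ Y) (g : Y ⟶ Z)
    (hdist : Triangle.mk h f
        (g ≫ (shiftFunctorCompIsoId C (-1 : ℤ) 1 (by simp)).inv.app Z) ∈ distTriang C) :
    (Mono ((toFactor T).map f) ↔ (toFactor T).map h = 0) ∧
    (Epi ((toFactor T).map f) ↔ (toFactor T).map g = 0) ∧
    (IsRegularMorphism ((toFactor T).map f) ↔
      (toFactor T).map g = 0 ∧ (toFactor T).map h = 0) := by
  have mono_iff : Mono ((toFactor T).map f) ↔ (toFactor T).map h = 0 :=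
    hT.mono_toFactor_map_iff hfin hdist
  have epi_iff : Epi ((toFactor T).map f) ↔ (toFactor T).map g = 0 := by
    rw [hT.epi_toFactor_map_iff hfin hdist, Functor.map_comp,
      Preadditive.IsIso.comp_right_eq_zero]
  exact ⟨mono_iff, epi_iff, by rw [IsRegularMorphism, mono_iff, epi_iff, and_comm]⟩

theorem lemma3p3 (k : Type w) [Field k] (C : Type u) [Category.{v} C] [EssentiallySmall.{v} C]
    [Preadditive C] [Linear k C] [HasZeroObject C] [HasShift C ℤ]
    [∀ n : ℤ, (shiftFunctor C n).Additive] [Pretriangulated C] [IsTriangulated C]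
    (hfin : IsHomFinite k C) (hKS : IsKrullSchmidt C) (S : SerreDuality k C)
    (T : C) (hT : IsRigid T)
    {X Y Z : C} (h : Z⟦(-1 : ℤ)⟧ ⟶ X) (f : X ⟶ Y) (g : Y ⟶ Z)
    -- the last map is `g` under the canonical identification `Z ≅ Σ(Σ⁻¹Z)`
    (hdist : Triangle.mk h f
        (g ≫ (shiftFunctorCompIsoId C (-1 : ℤ) 1 (by simp)).inv.app Z) ∈ distTriang C) :
    (Mono ((toFactor T).map f) ↔ (toFactor T).map h = 0) ∧
    (Epi ((toFactor T).map f) ↔ (toFactor T).map g = 0) ∧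
    (IsRegularMorphism ((toFactor T).map f) ↔
      (toFactor T).map g = 0 ∧ (toFactor T).map h = 0) :=
  lemma3p3_general hT (isContravariantlyFinite_addClosure (hfin T)) h f g hdist
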